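/- Let $0<q<1$ and let $a,b,c,d\in\mathbb C$ satisfy $\max\{|a|,|b|,|c|,|d|\}<1$ and $a\neq 0$. Write $(x;q)_n=\prod_{k=0}^{n-1}(1-xq^k)$, $(x;q)_\infty=\prod_{k\ge 0}(1-xq^k)$ and $(x_1,\dots,x_m;q)_n=(x_1;q)_n\cdots(x_m;q)_n$ for $n\in\mathbb N\cup\{\infty\}$. Let $\mathscr L_q:\mathbb C[x]\to\mathbb C$ be the linear functional of the Askey–Wilson polynomials, given by $$\mathscr L_q(x^n)=\frac{1}{2\pi}\,\frac{(q,ab,ac,ad,bc,bd,cd;q)_\infty}{(abcd;q)_\infty}\int_0^\pi\frac{(\cos\theta)^n\,(e^{2i\theta},e^{-2i\theta};q)_\infty\,d\theta}{(ae^{i\theta},ae^{-i\theta},be^{i\theta},be^{-i\theta},ce^{i\theta},ce^{-i\theta},de^{i\theta},de^{-i\theta};q)_\infty}\qquad(n\ge 0).$$ Put $a_j=(q^{-j}/a+aq^j)/2$ for $j\ge 0$. Then, as an identity of formal power series in $u$ over $\mathbb C$ (the sum on the right converging in the $u$-adic topology), $$\sum_{n=0}^\infty \mathscr L_q(x^n)\,u^n=\sum_{n=0}^\infty\frac{(ab,ac,ad;q)_n}{(abcd;q)_n}\,\frac{(-1)^n(2a)^{-n}q^{-\binom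 n2}\,u^n}{(1-a_0u)(1-a_1u)\cdots(1-a_nu)}.$$ -/

import Mathlib

open scoped Real PowerSeries

noncomputable section

/-- The finite `q`-shifted factorial `(x; q)_n = ∏_{k < n} (1 - x q^k)`. -/
def qPoch (x q : ℂ) (n : ℕ) : ℂ :=
  ∏ k ∈ Finset.range n, (1 - x * q ^ k)

/-- The infinite `q`-shifted factorial `(x; q)_∞ = ∏_{k ≥ 0} (1 - x q^k)`
(the product converges absolutely whenever `‖q‖ < 1`). -/
def qPochInf (x q : ℂ) : ℂ :=
  ∏' k : ℕ, (1 - x * q ^ k)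

/-- The function `θ ↦ (s e^{iθ}, s e^{-iθ}; q)_∞`. -/
def awFactor (q s : ℂ) (θ : ℝ) : ℂ :=
  qPochInf (s * Complex.exp (θ * Complex.I)) q * qPochInf (s * Complex.exp (-(θ * Complex.I))) q

/-- The Askey–Wilson weight on `[0, π]` (with respect to `dθ`, not normalized). -/
def awWeight (q a b c d : ℂ) (θ : ℝ) : ℂ :=
  qPochInf (Complex.exp (2 * (θ * Complex.I))) q * qPochInf (Complex.exp (-(2 * (θ * Complex.I)))) q /
    (awFactor q a θ * awFactor q b θ * awFactor q c θ * awFactor q d θ)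

/-- The normalization
`(1 / 2π) (q, ab, ac, ad, bc, bd, cd; q)_∞ / (abcd; q)_∞` of the Askey–Wilson integral. -/
def awNormalization (q a b c d : ℂ) : ℂ :=
  1 / (2 * π) *
    (qPochInf q q * qPochInf (a * b) q * qPochInf (a * c) q * qPochInf (a * d) q *
      qPochInf (b * c) q * qPochInf (b * d) q * qPochInf (c * d) q / qPochInf (a * b * c * d) q)

/-- The linear functional on `ℂ[x]` associated to the Askey–Wilson measure, given on monomials by
the integral of `cos^n θ` against the normalized weight. -/
def awFunctional (q a b c d : ℂ) : Polynomial ℂ →ₗ[ℂ] ℂ :=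
  (Polynomial.basisMonomials ℂ).constr ℂ fun n : ℕ =>
    awNormalization q a b c d *
      ∫ θ in (0 : ℝ)..π, ((Real.cos θ : ℝ) : ℂ) ^ n * awWeight q a b c d θ

/-- The interpolation nodes `a_j = (q^{-j} / a + a q^j) / 2`. -/
def awNode (q a : ℂ) (j : ℕ) : ℂ :=
  (q ^ (-(j : ℤ)) / a + a * q ^ j) / 2

/-- The `n`-th term of the expansion, a formal power series in `u`:
`(ab, ac, ad; q)_n / (abcd; q)_n * (-1)^n (2a)^{-n} q^{-binom(n,2)} u^n / ∏_{j ≤ n} (1 - a_j u)`.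
The denominator has constant coefficient `1`, so it is invertible. -/
def awTerm (q a b c d : ℂ) (n : ℕ) : ℂ⟦X⟧ :=
  PowerSeries.C
      (qPoch (a * b) q n * qPoch (a * c) q n * qPoch (a * d) q n / qPoch (a * b * c * d) q n *
        ((-1) ^ n * (2 * a) ^ (-(n : ℤ)) * q ^ (-(n.choose 2 : ℤ)))) *
    PowerSeries.X ^ n *
    (∏ j ∈ Finset.range (n + 1), (1 - PowerSeries.C (awNode q a j) * PowerSeries.X))⁻¹

/-- `S` is the sum of the family `f` in the sense of formal power series: every coefficient of the
finite partial sums is eventually equal to that of `S` (unconditional summability for the `u`-adic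
topology). -/
def HasFormalSum (f : ℕ → ℂ⟦X⟧) (S : ℂ⟦X⟧) : Prop :=
  ∀ k : ℕ, ∀ᶠ s : Finset ℕ in Filter.atTop,
    PowerSeries.coeff k (∑ n ∈ s, f n) = PowerSeries.coeff k S

end

/-! ### Infinite q-shifted factorials -/

section QPochhammer

/-! The coefficient of `u^k` in `u^n / ∏_{j ≤ n} (1 - a_j u)` is the divided difference of `x^k` at
`a_0, …, a_n`. Newton interpolation therefore expands `x^k` in the products `∏_{j < n} (x - a_j)`
with these coefficients (`sum_coeff_nodeSeries_smul_prod`), and it remains to evaluate the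
functional on each product.

At `x = cos θ` that product is a constant times `(a e^{iθ}, a e^{-iθ}; q)_n`, which turns the weight
with parameter `a` into the one with `a q^n`. Its value is thus a ratio of normalizations, provided
that the normalized weight has total mass 1 (`awNormalization_mul_awIntegral`).

This last fact is the Askey–Wilson integral. A contour argument on the annulus `1 ≤ |z| ≤ 1/q` gives
a first-order `q`-difference equation in `a` (`awIntegral_mul_left`), so `awMass` is invariant under
`a ↦ a q`. Letting `a q^n → 0` and using symmetry, it does not depend on the parameters. The
constant is read off at `q, -q, √q, -√q`, where the weight is `4 sin² θ` (`awMass_chebyshev`). -/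

theorem summable_norm_neg_mul_pow {q : ℂ} (hq : ‖q‖ < 1) (x : ℂ) :
    Summable fun k : ℕ => ‖-(x * q ^ k)‖ := by
  simpa using (summable_geometric_of_lt_one (norm_nonneg q) hq).mul_left ‖x‖

theorem multipliable_one_sub_mul_pow {q : ℂ} (hq : ‖q‖ < 1) (x : ℂ) :
    Multipliable fun k : ℕ => 1 - x * q ^ k := by
  simpa [sub_eq_add_neg] using multipliable_one_add_of_summable (summable_norm_neg_mul_pow hq x)

theorem qPochInf_eq_mul {q : ℂ} (hq : ‖q‖ < 1) (x : ℂ) :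
    qPochInf x q = (1 - x) * qPochInf (x * q) q := by
  have h := multipliable_one_sub_mul_pow hq (x * q)
  unfold qPochInf
  rw [tprod_eq_zero_mul' (f := fun k : ℕ => 1 - x * q ^ k)]
  · simp [pow_succ', mul_assoc]
  · simpa [pow_succ', mul_assoc] using h

theorem qPoch_succ (x q : ℂ) (n : ℕ) : qPoch x q (n + 1) = qPoch x q n * (1 - x * q ^ n) :=
  Finset.prod_range_succ _ _

theorem qPochInf_eq_qPoch_mul {q : ℂ} (hq : ‖q‖ < 1) (x : ℂ) (n : ℕ) :
    qPochInf x q = qPoch x q n * qPochInf (x * q ^ n) q := by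
  induction n with
  | zero => simp [qPoch]
  | succ n ih =>
    rw [ih, qPochInf_eq_mul hq (x * q ^ n), qPoch_succ, pow_succ]
    ring_nf

theorem qPochInf_ne_zero {q : ℂ} (hq : ‖q‖ < 1) {x : ℂ} (hx : ‖x‖ < 1) : qPochInf x q ≠ 0 := by
  have h := tprod_one_add_ne_zero_of_summable (f := fun k : ℕ => -(x * q ^ k)) (fun k h => ?_)
    (summable_norm_neg_mul_pow hq x)
  · simpa [qPochInf, sub_eq_add_neg] using h
  · have h1 : x * q ^ k = 1 := by linear_combination -h
    have h2 : ‖x‖ * ‖q‖ ^ k = 1 := by simpa using congrArg norm h1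
    have h3 : ‖q‖ ^ k ≤ 1 := pow_le_one₀ (norm_nonneg _) hq.le
    nlinarith [norm_nonneg x]

theorem differentiable_qPochInf {q : ℂ} (hq : ‖q‖ < 1) : Differentiable ℂ fun x => qPochInf x q := by
  intro x
  have hprod : HasProdLocallyUniformlyOn (fun (k : ℕ) (y : ℂ) => 1 + -(y * q ^ k))
      (fun y => ∏' k : ℕ, (1 + -(y * q ^ k))) (Metric.ball 0 (‖x‖ + 1)) := by
    refine Summable.hasProdLocallyUniformlyOn_nat_one_add Metric.isOpen_ball
      ((summable_geometric_of_lt_one (norm_nonneg q) hq).mul_left (‖x‖ + 1))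
      (.of_forall fun k y hy => ?_) fun k => by fun_prop
    have : ‖y‖ ≤ ‖x‖ + 1 := by simpa using (mem_ball_zero_iff.mp hy).le
    simpa using mul_le_mul_of_nonneg_right this (pow_nonneg (norm_nonneg q) k)
  have hd := hprod.differentiableOn (.of_forall fun s => by
    simpa [Finset.prod_fn] using DifferentiableOn.finsetProd (fun _ _ => by fun_prop))
    Metric.isOpen_ball
  have := hd.differentiableAt (Metric.isOpen_ball.mem_nhds (by simp : x ∈ Metric.ball 0 (‖x‖ + 1)))
  simpa [qPochInf, sub_eq_add_neg] using this

theorem continuous_qPochInf {q : ℂ} (hq : ‖q‖ < 1) : Continuous fun x => qPochInf x q :=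
  (differentiable_qPochInf hq).continuous

theorem qPochInf_mul_qPochInf_neg {q : ℂ} (hq : ‖q‖ < 1) (x : ℂ) :
    qPochInf x q * qPochInf (-x) q = qPochInf (x ^ 2) (q ^ 2) := by
  unfold qPochInf
  rw [← (multipliable_one_sub_mul_pow hq x).tprod_mul (multipliable_one_sub_mul_pow hq (-x))]
  exact tprod_congr fun k => by ring

theorem qPochInf_sq_mul_qPochInf_sq {q : ℂ} (hq : ‖q‖ < 1) (x : ℂ) :
    qPochInf x (q ^ 2) * qPochInf (x * q) (q ^ 2) = qPochInf x q := by
  have hq2 : ‖q ^ 2‖ < 1 := by simpa using pow_lt_one₀ (norm_nonneg q) hq two_ne_zero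
  have h0 := multipliable_one_sub_mul_pow hq2 x
  have h1 := multipliable_one_sub_mul_pow hq2 (x * q)
  have := tprod_even_mul_odd (f := fun k : ℕ => 1 - x * q ^ k)
    (by simpa [pow_mul] using h0) (by simpa [pow_mul, pow_succ', mul_assoc] using h1)
  simpa [qPochInf, pow_mul, pow_succ', mul_assoc] using this

/-- Euler's identity `(q; q²)_∞ (-q; q)_∞ = 1`. -/
theorem qPochInf_sq_mul_qPochInf_neg {q : ℂ} (hq : ‖q‖ < 1) :
    qPochInf q (q ^ 2) * qPochInf (-q) q = 1 := by
  have h1 := qPochInf_sq_mul_qPochInf_sq hq q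
  have h2 := qPochInf_mul_qPochInf_neg hq q
  rw [← sq, ← h2] at h1
  refine mul_left_cancel₀ (qPochInf_ne_zero hq hq) ?_
  linear_combination h1

end QPochhammer

/-! ### Formal series attached to nodes, and Newton interpolation -/

section FormalExpansion

/-- The `n`-th basic series `u^n / ∏_{j ≤ n} (1 - x_j u)` attached to a sequence of nodes `x`. -/
noncomputable def nodeSeries {K : Type*} [Field K] (x : ℕ → K) (n : ℕ) : K⟦X⟧ :=
  PowerSeries.X ^ n * (∏ j ∈ Finset.range (n + 1), (1 - PowerSeries.C (x j) * PowerSeries.X))⁻¹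

variable {K : Type*} [Field K]

theorem coeff_nodeSeries_eq_zero (x : ℕ → K) {n k : ℕ} (h : k < n) :
    PowerSeries.coeff k (nodeSeries x n) = 0 := by
  rw [nodeSeries, PowerSeries.coeff_X_pow_mul', if_neg (by omega)]

theorem one_sub_mul_nodeSeries_zero (x : ℕ → K) :
    (1 - PowerSeries.C (x 0) * PowerSeries.X) * nodeSeries x 0 = 1 := by
  simp only [nodeSeries, zero_add, Finset.prod_range_one, pow_zero, one_mul]
  exact PowerSeries.mul_inv_cancel _ (by simp)

theorem one_sub_mul_nodeSeries_succ (x : ℕ → K) (n : ℕ) :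
    (1 - PowerSeries.C (x (n + 1)) * PowerSeries.X) * nodeSeries x (n + 1) =
      PowerSeries.X * nodeSeries x n := by
  have h : (1 - PowerSeries.C (x (n + 1)) * PowerSeries.X) *
      (1 - PowerSeries.C (x (n + 1)) * PowerSeries.X)⁻¹ = 1 :=
    PowerSeries.mul_inv_cancel _ (by simp)
  simp only [nodeSeries]
  rw [Finset.prod_range_succ _ (n + 1), PowerSeries.mul_inv_rev]
  linear_combination (PowerSeries.X ^ (n + 1) * (∏ j ∈ Finset.range (n + 1),
    (1 - PowerSeries.C (x j) * PowerSeries.X))⁻¹) * h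

theorem coeff_succ_nodeSeries_zero (x : ℕ → K) (k : ℕ) :
    PowerSeries.coeff (k + 1) (nodeSeries x 0) = x 0 * PowerSeries.coeff k (nodeSeries x 0) := by
  have h := congrArg (PowerSeries.coeff (k + 1)) (one_sub_mul_nodeSeries_zero x)
  rw [sub_mul, one_mul, mul_assoc, map_sub, PowerSeries.coeff_C_mul,
    PowerSeries.coeff_succ_X_mul, PowerSeries.coeff_one, if_neg (by omega)] at h
  linear_combination h

theorem coeff_succ_nodeSeries_succ (x : ℕ → K) (n k : ℕ) :
    PowerSeries.coeff (k + 1) (nodeSeries x (n + 1)) =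
      x (n + 1) * PowerSeries.coeff k (nodeSeries x (n + 1)) +
        PowerSeries.coeff k (nodeSeries x n) := by
  have h := congrArg (PowerSeries.coeff (k + 1)) (one_sub_mul_nodeSeries_succ x n)
  rw [sub_mul, one_mul, mul_assoc, map_sub, PowerSeries.coeff_C_mul,
    PowerSeries.coeff_succ_X_mul, PowerSeries.coeff_succ_X_mul] at h
  linear_combination h

/-- The Newton expansion of a power: the coefficients of `nodeSeries` are the divided differences
of the monomials. -/
theorem sum_coeff_nodeSeries_mul_prod (x : ℕ → K) (t : K) (k m : ℕ) (hm : k < m) :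
    ∑ n ∈ Finset.range m, PowerSeries.coeff k (nodeSeries x n) *
      ∏ j ∈ Finset.range n, (t - x j) = t ^ k := by
  induction k generalizing m with
  | zero =>
    obtain ⟨m, rfl⟩ : ∃ l, m = l + 1 := ⟨m - 1, by omega⟩
    rw [Finset.sum_range_succ', Finset.sum_eq_zero fun n _ => by
      rw [coeff_nodeSeries_eq_zero x n.succ_pos, zero_mul]]
    have h := congrArg PowerSeries.constantCoeff (one_sub_mul_nodeSeries_zero x)
    simp only [map_mul, map_sub, map_one, PowerSeries.constantCoeff_X, mul_zero, sub_zero,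
      one_mul] at h
    simp [h]
  | succ k ih =>
    obtain ⟨m, rfl⟩ : ∃ l, m = l + 1 := ⟨m - 1, by omega⟩
    have h1 := ih (m + 1) (by omega)
    have h2 := ih m (by omega)
    rw [Finset.sum_range_succ'] at h1 ⊢
    simp only [coeff_succ_nodeSeries_succ, coeff_succ_nodeSeries_zero]
    -- Multiply the expansion of `t^k` by `t = (t - x n) + x n`: the first summand lengthens the
    -- product by one factor, the second keeps it. This mirrors the recurrence for the coefficients.
    have h3 : ∑ n ∈ Finset.range m, PowerSeries.coeff k (nodeSeries x n) *
        (∏ j ∈ Finset.range n, (t - x j)) * (t - x n) +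
        ∑ n ∈ Finset.range (m + 1), x n * (PowerSeries.coeff k (nodeSeries x n) *
          ∏ j ∈ Finset.range n, (t - x j)) = t ^ (k + 1) := by
      have h4 : PowerSeries.coeff k (nodeSeries x m) * ∏ j ∈ Finset.range m, (t - x j) = 0 := by
        rw [coeff_nodeSeries_eq_zero x (by omega), zero_mul]
      rw [Finset.sum_range_succ, h4, mul_zero, add_zero, ← Finset.sum_add_distrib, pow_succ',
        ← h2, Finset.mul_sum]
      exact Finset.sum_congr rfl fun n _ => by ring
    rw [← h3, Finset.sum_range_succ' _ m, ← add_assoc, ← Finset.sum_add_distrib]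
    congr 1
    · exact Finset.sum_congr rfl fun n _ => by rw [Finset.prod_range_succ]; ring
    · ring

end FormalExpansion

/-! ### The contour integral behind the q-difference equation -/

section Contour

open Complex MeasureTheory Set

/-- `(az, bz, cz, dz; q)_∞`. -/
noncomputable def awDenom (q a b c d z : ℂ) : ℂ :=
  qPochInf (a * z) q * qPochInf (b * z) q * qPochInf (c * z) q * qPochInf (d * z) q

variable {q a b c d : ℂ}

theorem differentiable_awDenom (hq : ‖q‖ < 1) (a b c d : ℂ) :
    Differentiable ℂ (awDenom q a b c d) := by
  have h (s : ℂ) : Differentiable ℂ fun z => qPochInf (s * z) q :=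
    (differentiable_qPochInf hq).comp (by fun_prop)
  exact (((h a).mul (h b)).mul (h c)).mul (h d)

theorem awDenom_ne_zero (hq : ‖q‖ < 1) (ha : ‖a‖ < 1) (hb : ‖b‖ < 1) (hc : ‖c‖ < 1)
    (hd : ‖d‖ < 1) {z : ℂ} (hz : ‖z‖ ≤ 1) : awDenom q a b c d z ≠ 0 := by
  have h {s : ℂ} (hs : ‖s‖ < 1) : qPochInf (s * z) q ≠ 0 :=
    qPochInf_ne_zero hq (by rw [norm_mul]; nlinarith [norm_nonneg s, norm_nonneg z])
  exact mul_ne_zero (mul_ne_zero (mul_ne_zero (h ha) (h hb)) (h hc)) (h hd)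

theorem awDenom_eq_mul (hq : ‖q‖ < 1) (a b c d z : ℂ) :
    awDenom q a b c d z =
      (1 - a * z) * (1 - b * z) * (1 - c * z) * (1 - d * z) * awDenom q a b c d (z * q) := by
  simp only [awDenom]
  rw [qPochInf_eq_mul hq (a * z), qPochInf_eq_mul hq (b * z), qPochInf_eq_mul hq (c * z),
    qPochInf_eq_mul hq (d * z)]
  simp only [mul_assoc]
  ring

theorem awWeight_eq_div_awDenom (q a b c d : ℂ) (θ : ℝ) :
    awWeight q a b c d θ =
      qPochInf (exp (θ * I) ^ 2) q * qPochInf ((exp (θ * I))⁻¹ ^ 2) q /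
        (awDenom q a b c d (exp (θ * I)) * awDenom q a b c d (exp (θ * I))⁻¹) := by
  have h1 : exp (2 * (θ * I)) = exp (θ * I) ^ 2 := by rw [← exp_nat_mul]; norm_num
  have h2 : exp (-(2 * (θ * I))) = (exp (θ * I))⁻¹ ^ 2 := by
    rw [← exp_neg, ← exp_nat_mul]; congr 1; push_cast; ring
  simp only [awWeight, awFactor, awDenom, h1, h2, exp_neg]
  ring

/-- The function whose integral over the unit circle expresses the `q`-difference equation of
the Askey–Wilson weight. -/
noncomputable def awKernel (q a b c d z : ℂ) : ℂ :=
  z⁻¹ * (qPochInf (z ^ 2 * q) q * qPochInf (z⁻¹ ^ 2) q) /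
    (awDenom q a b c d (z * q) * awDenom q a b c d z⁻¹)

/-- The map `z ↦ 1/(zq)` swaps the two denominators; the sign comes from `zq (1 - 1/(z²q)) = -z⁻¹ (1
- z²q)`. It exchanges the circles of radius `1` and `1/|q|`. -/
theorem awKernel_inv_mul (hq : ‖q‖ < 1) (hq0 : q ≠ 0) {z : ℂ} (hz : z ≠ 0) :
    awKernel q a b c d (z * q)⁻¹ = -awKernel q a b c d z := by
  have e1 : (z * q)⁻¹ ^ 2 * q = (z ^ 2 * q)⁻¹ := by field_simp
  have e2 : (z ^ 2 * q)⁻¹ * q = z⁻¹ ^ 2 := by field_simp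
  have e3 : (z * q)⁻¹ * q = z⁻¹ := by field_simp
  have e4 : (z * q) ^ 2 = z ^ 2 * q * q := by ring
  simp only [awKernel, inv_inv, e1, e3, e4]
  rw [qPochInf_eq_mul hq (z ^ 2 * q)⁻¹, qPochInf_eq_mul hq (z ^ 2 * q), e2, ← neg_div,
    mul_comm (awDenom q a b c d z⁻¹)]
  congr 1
  field_simp
  ring

/-- Relative to the weight, the kernel is `z⁻² ∏ (1 - s z) / (z⁻¹ - z)`, with `s` over the four
parameters. Symmetrizing makes the numerator antisymmetric, so the division is exact and leaves a
polynomial of degree one in `z + z⁻¹`. -/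
theorem awKernel_add_awKernel_inv (hq : ‖q‖ < 1) (ha : ‖a‖ < 1) (hb : ‖b‖ < 1) (hc : ‖c‖ < 1)
    (hd : ‖d‖ < 1) {z : ℂ} (hz : ‖z‖ = 1) :
    awKernel q a b c d z + awKernel q a b c d z⁻¹ =
      ((z + z⁻¹) * (1 - a * b * c * d) - (a + b + c + d) +
        (a * b * c + a * b * d + a * c * d + b * c * d)) *
        (qPochInf (z ^ 2) q * qPochInf (z⁻¹ ^ 2) q /
          (awDenom q a b c d z * awDenom q a b c d z⁻¹)) := by
  have hz0 : z ≠ 0 := norm_ne_zero_iff.mp (by simp [hz])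
  have hz' : ‖z⁻¹‖ = 1 := by simp [hz]
  have h1 := awDenom_ne_zero hq ha hb hc hd hz.le
  have h2 := awDenom_ne_zero hq ha hb hc hd hz'.le
  have e1 := awDenom_eq_mul hq a b c d z
  have e2 := awDenom_eq_mul hq a b c d z⁻¹
  have h3 : awDenom q a b c d (z * q) ≠ 0 := fun h => h1 (by rw [e1, h, mul_zero])
  have h4 : awDenom q a b c d (z⁻¹ * q) ≠ 0 := fun h => h2 (by rw [e2, h, mul_zero])
  -- The factors `1 - z²` and `1 - z⁻²` are kept out of the common factor, since they vanish at `z =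
  -- ±1` and cannot be divided by.
  have k1 : awKernel q a b c d z =
      z⁻¹ * (1 - z⁻¹ ^ 2) * ((1 - a * z) * (1 - b * z) * (1 - c * z) * (1 - d * z)) *
        (qPochInf (z ^ 2 * q) q * qPochInf (z⁻¹ ^ 2 * q) q /
          (awDenom q a b c d z * awDenom q a b c d z⁻¹)) := by
    rw [awKernel, qPochInf_eq_mul hq (z⁻¹ ^ 2), mul_div_assoc', div_eq_div_iff
      (mul_ne_zero h3 h2) (mul_ne_zero h1 h2), e1]
    ring
  have k2 : awKernel q a b c d z⁻¹ =
      z * (1 - z ^ 2) * ((1 - a * z⁻¹) * (1 - b * z⁻¹) * (1 - c * z⁻¹) * (1 - d * z⁻¹)) *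
        (qPochInf (z ^ 2 * q) q * qPochInf (z⁻¹ ^ 2 * q) q /
          (awDenom q a b c d z * awDenom q a b c d z⁻¹)) := by
    rw [awKernel, inv_inv, qPochInf_eq_mul hq (z ^ 2), mul_div_assoc', div_eq_div_iff
      (mul_ne_zero h4 h1) (mul_ne_zero h1 h2), e2]
    ring
  rw [k1, k2, qPochInf_eq_mul hq (z ^ 2), qPochInf_eq_mul hq (z⁻¹ ^ 2), mul_mul_mul_comm (1 - z ^ 2),
    mul_div_assoc ((1 - z ^ 2) * (1 - z⁻¹ ^ 2)), ← add_mul,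
    ← mul_assoc _ ((1 - z ^ 2) * (1 - z⁻¹ ^ 2))]
  congr 1
  field_simp
  ring

theorem differentiableAt_awKernel (hq : ‖q‖ < 1) (ha : ‖a‖ < 1) (hb : ‖b‖ < 1) (hc : ‖c‖ < 1)
    (hd : ‖d‖ < 1) {z : ℂ} (h1 : 1 ≤ ‖z‖) (h2 : ‖z * q‖ ≤ 1) :
    DifferentiableAt ℂ (awKernel q a b c d) z := by
  have hz0 : z ≠ 0 := norm_pos_iff.mp (by linarith)
  have hP (x : ℂ) : DifferentiableAt ℂ (fun x => qPochInf x q) x := differentiable_qPochInf hq x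
  have hD (x : ℂ) : DifferentiableAt ℂ (awDenom q a b c d) x := differentiable_awDenom hq _ _ _ _ x
  have hinv : DifferentiableAt ℂ (fun z : ℂ => z⁻¹) z := differentiableAt_inv hz0
  refine DifferentiableAt.div (hinv.mul (DifferentiableAt.mul ?_ ?_)) (DifferentiableAt.mul ?_ ?_)
    (mul_ne_zero (awDenom_ne_zero hq ha hb hc hd h2)
      (awDenom_ne_zero hq ha hb hc hd (by simpa using inv_le_one_of_one_le₀ h1)))
  · exact DifferentiableAt.comp (f := fun z => z ^ 2 * q) z (hP _) (by fun_prop)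
  · exact DifferentiableAt.comp (f := fun z : ℂ => z⁻¹ ^ 2) z (hP _) (hinv.pow 2)
  · exact DifferentiableAt.comp (f := fun z => z * q) z (hD _) (by fun_prop)
  · exact DifferentiableAt.comp (f := fun z : ℂ => z⁻¹) z (hD _) hinv

theorem circleIntegral_inv_mul_eq (f : ℂ → ℂ) {R : ℝ} (hR : R ≠ 0) :
    (∮ z in C(0, R), (z - 0)⁻¹ • f z) = I * ∫ θ in (0 : ℝ)..2 * π, f (circleMap 0 R θ) := by
  rw [circleIntegral, ← intervalIntegral.integral_const_mul]
  refine intervalIntegral.integral_congr fun θ _ => ?_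
  have : circleMap 0 R θ ≠ 0 := circleMap_ne_center hR
  simp only [deriv_circleMap, smul_eq_mul, sub_zero]
  field_simp

theorem integral_comp_circleMap_neg (f : ℂ → ℂ) :
    ∫ θ in (0 : ℝ)..2 * π, f (circleMap 0 1 (-θ)) = ∫ θ in (0 : ℝ)..2 * π, f (circleMap 0 1 θ) := by
  have h (θ : ℝ) : circleMap 0 1 (-θ) = circleMap 0 1 (2 * π - θ) := by
    rw [← periodic_circleMap 0 1 (-θ)]; congr 1; ring
  simp only [h]
  simpa using intervalIntegral.integral_comp_sub_left (a := 0) (b := 2 * π)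
    (fun θ => f (circleMap 0 1 θ)) (2 * π)

/-- The kernel is holomorphic on `1 ≤ |z| ≤ 1/q`, so its means over the two boundary circles agree;
by `awKernel_inv_mul` they are also opposite. -/
theorem integral_awKernel_eq_zero {q : ℝ} (hq0 : 0 < q) (hq1 : q < 1)
    (ha : ‖a‖ < 1) (hb : ‖b‖ < 1) (hc : ‖c‖ < 1) (hd : ‖d‖ < 1) :
    ∫ θ in (0 : ℝ)..2 * π, awKernel q a b c d (circleMap 0 1 θ) = 0 := by
  have hq : ‖(q : ℂ)‖ < 1 := by simpa [abs_of_pos hq0] using hq1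
  have hqc : (q : ℂ) ≠ 0 := by exact_mod_cast hq0.ne'
  have hdiff {z : ℂ} (h1 : 1 ≤ ‖z‖) (h2 : ‖z‖ ≤ q⁻¹) :
      DifferentiableAt ℂ (awKernel q a b c d) z := by
    refine differentiableAt_awKernel hq ha hb hc hd h1 ?_
    rw [norm_mul, norm_real, Real.norm_of_nonneg hq0.le]
    calc ‖z‖ * q ≤ q⁻¹ * q := by gcongr
      _ = 1 := inv_mul_cancel₀ hq0.ne'
  have key := Complex.circleIntegral_sub_center_inv_smul_eq_of_differentiable_on_annulus_off_countable
    (c := 0) (r := 1) (R := q⁻¹) (f := awKernel q a b c d) one_pos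
    ((one_le_inv₀ hq0).mpr hq1.le) countable_empty
    (fun z hz => (hdiff (by simpa using hz.2) (by simpa using hz.1)).continuousAt.continuousWithinAt)
    (fun z hz => hdiff (not_lt.mp fun h => hz.1.2 (by simpa using h.le))
      (by simpa using (mem_ball_zero_iff.mp hz.1.1).le))
  rw [circleIntegral_inv_mul_eq _ (inv_ne_zero hq0.ne'), circleIntegral_inv_mul_eq _ one_ne_zero] at key
  have hreflect (θ : ℝ) : awKernel q a b c d (circleMap 0 q⁻¹ θ) =
      -awKernel q a b c d (circleMap 0 1 (-θ)) := by
    rw [← awKernel_inv_mul hq hqc (circleMap_ne_center one_ne_zero)]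
    congr 1
    simp [circleMap, exp_neg]
  simp only [hreflect, intervalIntegral.integral_neg,
    integral_comp_circleMap_neg (awKernel q a b c d)] at key
  have := mul_left_cancel₀ I_ne_zero key
  linear_combination -this / 2

theorem continuous_awKernel_circleMap (hq : ‖q‖ < 1) (ha : ‖a‖ < 1) (hb : ‖b‖ < 1) (hc : ‖c‖ < 1)
    (hd : ‖d‖ < 1) : Continuous fun θ : ℝ => awKernel q a b c d (circleMap 0 1 θ) := by
  refine continuous_iff_continuousAt.mpr fun θ => ContinuousAt.comp (g := awKernel q a b c d)
    (differentiableAt_awKernel hq ha hb hc hd (by simp) ?_).continuousAt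
    (continuous_circleMap 0 1).continuousAt
  simpa using hq.le

theorem integral_awKernel_add_eq_zero {q : ℝ} (hq0 : 0 < q) (hq1 : q < 1)
    (ha : ‖a‖ < 1) (hb : ‖b‖ < 1) (hc : ‖c‖ < 1) (hd : ‖d‖ < 1) :
    ∫ θ in (0 : ℝ)..π, (awKernel q a b c d (exp (θ * I)) + awKernel q a b c d (exp (θ * I))⁻¹) =
      0 := by
  have hq : ‖(q : ℂ)‖ < 1 := by simpa [abs_of_pos hq0] using hq1
  have hcont := continuous_awKernel_circleMap hq ha hb hc hd
  have hcont' : Continuous fun θ : ℝ => awKernel q a b c d (circleMap 0 1 (-θ)) :=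
    hcont.comp continuous_neg
  have hper : Function.Periodic (fun θ : ℝ => awKernel q a b c d (circleMap 0 1 θ)) (2 * π) :=
    fun θ => by simp only [periodic_circleMap 0 1 θ]
  have h0 := hper.intervalIntegral_add_eq 0 (-π)
  rw [zero_add, integral_awKernel_eq_zero hq0 hq1 ha hb hc hd,
    show -π + 2 * π = π by ring] at h0
  rw [← intervalIntegral.integral_add_adjacent_intervals (b := 0)
    (hcont.intervalIntegrable _ _) (hcont.intervalIntegrable _ _)] at h0
  have h1 := intervalIntegral.integral_comp_neg (a := 0) (b := π)
    (fun θ : ℝ => awKernel q a b c d (circleMap 0 1 θ))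
  rw [neg_zero] at h1
  rw [← h1, ← intervalIntegral.integral_add (hcont'.intervalIntegrable _ _)
    (hcont.intervalIntegrable _ _)] at h0
  rw [h0]
  refine intervalIntegral.integral_congr fun θ _ => ?_
  simp [circleMap, exp_neg, add_comm]

end Contour

/-! ### Evaluation of the Askey–Wilson integral -/

section AskeyWilsonIntegral

open Complex MeasureTheory Set Filter Topology

variable {q a b c d : ℂ}

theorem Continuous.qPochInf_comp {X : Type*} [TopologicalSpace X] {f : X → ℂ} (hf : Continuous f)
    (hq : ‖q‖ < 1) : Continuous fun x => qPochInf (f x) q :=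
  (continuous_qPochInf hq).comp hf

theorem Continuous.awFactor_comp {X : Type*} [TopologicalSpace X] {f : X → ℂ} {g : X → ℝ}
    (hf : Continuous f) (hg : Continuous g) (hq : ‖q‖ < 1) :
    Continuous fun x => awFactor q (f x) (g x) := by
  unfold awFactor
  have h1 : Continuous fun x => f x * exp (g x * I) := by fun_prop
  have h2 : Continuous fun x => f x * exp (-(g x * I)) := by fun_prop
  exact (h1.qPochInf_comp hq).mul (h2.qPochInf_comp hq)

theorem awFactor_ne_zero (hq : ‖q‖ < 1) (ha : ‖a‖ < 1) (θ : ℝ) : awFactor q a θ ≠ 0 := by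
  have h1 : ‖exp (-(θ * I))‖ = 1 := by
    rw [exp_neg, norm_inv, norm_exp_ofReal_mul_I, inv_one]
  exact mul_ne_zero (qPochInf_ne_zero hq (by rwa [norm_mul, norm_exp_ofReal_mul_I, mul_one]))
    (qPochInf_ne_zero hq (by rwa [norm_mul, h1, mul_one]))

theorem Continuous.awWeight_comp {X : Type*} [TopologicalSpace X] {f : X → ℂ} {g : X → ℝ}
    (hf : Continuous f) (hg : Continuous g) (hq : ‖q‖ < 1) (hf1 : ∀ x, ‖f x‖ < 1)
    (hb : ‖b‖ < 1) (hc : ‖c‖ < 1) (hd : ‖d‖ < 1) :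
    Continuous fun x => awWeight q (f x) b c d (g x) := by
  have h1 : Continuous fun x => exp (2 * (g x * I)) := by fun_prop
  have h2 : Continuous fun x => exp (-(2 * (g x * I))) := by fun_prop
  have hF (s : ℂ) : Continuous fun x => awFactor q s (g x) :=
    continuous_const.awFactor_comp hg hq
  unfold awWeight
  exact ((h1.qPochInf_comp hq).mul (h2.qPochInf_comp hq)).div
    ((((hf.awFactor_comp hg hq).mul (hF b)).mul (hF c)).mul (hF d)) fun x =>
      mul_ne_zero (mul_ne_zero (mul_ne_zero (awFactor_ne_zero hq (hf1 x) _)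
        (awFactor_ne_zero hq hb _)) (awFactor_ne_zero hq hc _)) (awFactor_ne_zero hq hd _)

theorem continuous_awWeight (hq : ‖q‖ < 1) (ha : ‖a‖ < 1) (hb : ‖b‖ < 1) (hc : ‖c‖ < 1)
    (hd : ‖d‖ < 1) : Continuous fun θ : ℝ => awWeight q a b c d θ :=
  Continuous.awWeight_comp continuous_const continuous_id hq (fun _ => ha) hb hc hd

theorem awFactor_eq_mul (hq : ‖q‖ < 1) (a : ℂ) (θ : ℝ) :
    awFactor q a θ = (1 - 2 * a * Real.cos θ + a ^ 2) * awFactor q (a * q) θ := by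
  have h1 : exp (-(θ * I)) = (exp (θ * I))⁻¹ := exp_neg _
  have h2 : (2 : ℂ) * Real.cos θ = exp (θ * I) + exp (-(θ * I)) := by
    rw [ofReal_cos, two_cos, neg_mul]
  have h3 : exp (θ * I) * exp (-(θ * I)) = 1 := by rw [← exp_add, add_neg_cancel, exp_zero]
  rw [awFactor, awFactor, qPochInf_eq_mul hq (a * exp (θ * I)),
    qPochInf_eq_mul hq (a * exp (-(θ * I))), mul_right_comm a _ q, mul_right_comm a _ q,
    show 2 * a * (Real.cos θ : ℂ) = a * (2 * Real.cos θ) by ring, h2]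
  linear_combination (a ^ 2 * (qPochInf (a * q * exp (θ * I)) q *
    qPochInf (a * q * exp (-(θ * I))) q)) * h3

theorem norm_mul_lt_one {x y : ℂ} (hx : ‖x‖ < 1) (hy : ‖y‖ < 1) : ‖x * y‖ < 1 := by
  rw [norm_mul]
  nlinarith [norm_nonneg x, norm_nonneg y]

theorem one_sub_ne_zero_of_norm_lt_one {x : ℂ} (hx : ‖x‖ < 1) : 1 - x ≠ 0 := by
  intro h
  rw [← sub_eq_zero.mp h, norm_one] at hx
  exact lt_irrefl _ hx

theorem awWeight_mul_left (hq : ‖q‖ < 1) (ha : ‖a‖ < 1) (b c d : ℂ) (θ : ℝ) :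
    awWeight q (a * q) b c d θ =
      (1 - 2 * a * Real.cos θ + a ^ 2) * awWeight q a b c d θ := by
  have h := awFactor_ne_zero hq ha θ
  rw [awFactor_eq_mul hq] at h
  rw [awWeight, awWeight, awFactor_eq_mul hq a, mul_assoc (1 - 2 * a * (Real.cos θ : ℂ) + a ^ 2),
    mul_assoc (1 - 2 * a * (Real.cos θ : ℂ) + a ^ 2),
    mul_assoc (1 - 2 * a * (Real.cos θ : ℂ) + a ^ 2), mul_div_assoc',
    mul_div_mul_left _ _ (left_ne_zero_of_mul h)]

/-- The unnormalized Askey–Wilson integral. -/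
noncomputable def awIntegral (q a b c d : ℂ) : ℂ :=
  ∫ θ in (0 : ℝ)..π, awWeight q a b c d θ

theorem awIntegral_mul_left {q : ℝ} (hq0 : 0 < q) (hq1 : q < 1)
    (ha : ‖a‖ < 1) (hb : ‖b‖ < 1) (hc : ‖c‖ < 1) (hd : ‖d‖ < 1) :
    (1 - a * b * c * d) * awIntegral q (a * q) b c d =
      (1 - a * b) * (1 - a * c) * (1 - a * d) * awIntegral q a b c d := by
  have hq : ‖(q : ℂ)‖ < 1 := by simpa [abs_of_pos hq0] using hq1
  have hW := continuous_awWeight hq ha hb hc hd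
  have hK : Continuous fun θ : ℝ => (2 * Real.cos θ * (1 - a * b * c * d) - (a + b + c + d) +
      (a * b * c + a * b * d + a * c * d + b * c * d)) * awWeight q a b c d θ :=
    Continuous.mul (by fun_prop) hW
  have h0 : ∫ θ in (0 : ℝ)..π, (2 * Real.cos θ * (1 - a * b * c * d) - (a + b + c + d) +
      (a * b * c + a * b * d + a * c * d + b * c * d)) * awWeight q a b c d θ = 0 := by
    rw [← integral_awKernel_add_eq_zero hq0 hq1 ha hb hc hd]
    refine intervalIntegral.integral_congr fun θ _ => ?_
    rw [awKernel_add_awKernel_inv hq ha hb hc hd (norm_exp_ofReal_mul_I θ),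
      ← awWeight_eq_div_awDenom, ofReal_cos, two_cos, neg_mul, exp_neg]
  -- Passing to `a q` multiplies the weight by `1 - 2a cos θ + a²`. Subtracting `a` times the
  -- symmetrized kernel, whose integral is zero, eliminates `cos θ`, and the remaining constant
  -- factors.
  have h1 : ∀ θ : ℝ, (1 - a * b * c * d) * awWeight q (a * q) b c d θ =
      (1 - a * b) * (1 - a * c) * (1 - a * d) * awWeight q a b c d θ -
        a * ((2 * Real.cos θ * (1 - a * b * c * d) - (a + b + c + d) +
          (a * b * c + a * b * d + a * c * d + b * c * d)) * awWeight q a b c d θ) := fun θ => by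
    rw [awWeight_mul_left hq ha]
    ring
  unfold awIntegral
  rw [← intervalIntegral.integral_const_mul, ← intervalIntegral.integral_const_mul]
  simp only [h1]
  rw [intervalIntegral.integral_sub, intervalIntegral.integral_const_mul a, h0, mul_zero, sub_zero]
  · exact (hW.const_mul _).intervalIntegrable _ _
  · exact (hK.const_mul _).intervalIntegrable _ _

/-- The Askey–Wilson integral multiplied by the infinite products of its evaluation, which turns
out not to depend on the parameters. -/
noncomputable def awMass (q a b c d : ℂ) : ℂ :=
  awIntegral q a b c d * (qPochInf (a * b) q * qPochInf (a * c) q * qPochInf (a * d) q *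
    qPochInf (b * c) q * qPochInf (b * d) q * qPochInf (c * d) q) / qPochInf (a * b * c * d) q

/-- A cyclic shift is all the symmetry needed to bring each parameter in turn to the first slot. -/
theorem awMass_rotate (q a b c d : ℂ) : awMass q a b c d = awMass q b c d a := by
  have h : awIntegral q a b c d = awIntegral q b c d a :=
    intervalIntegral.integral_congr fun θ _ => by
      simp only [awWeight]
      ring
  rw [awMass, awMass, h, mul_comm b a, mul_comm c a, mul_comm d a,
    show a * b * c * d = b * c * d * a by ring]
  ring

theorem awMass_mul_left {q : ℝ} (hq0 : 0 < q) (hq1 : q < 1)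
    (ha : ‖a‖ < 1) (hb : ‖b‖ < 1) (hc : ‖c‖ < 1) (hd : ‖d‖ < 1) :
    awMass q (a * q) b c d = awMass q a b c d := by
  have hq : ‖(q : ℂ)‖ < 1 := by simpa [abs_of_pos hq0] using hq1
  have h := awIntegral_mul_left hq0 hq1 ha hb hc hd
  have habcd := norm_mul_lt_one (norm_mul_lt_one (norm_mul_lt_one ha hb) hc) hd
  have h1 := one_sub_ne_zero_of_norm_lt_one habcd
  have h2 := qPochInf_ne_zero hq (norm_mul_lt_one habcd hq)
  rw [awMass, awMass, qPochInf_eq_mul hq (a * b), qPochInf_eq_mul hq (a * c),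
    qPochInf_eq_mul hq (a * d), qPochInf_eq_mul hq (a * b * c * d),
    show a * q * b * c * d = a * b * c * d * q by ring, mul_right_comm a _ b, mul_right_comm a _ c,
    mul_right_comm a _ d, div_eq_div_iff h2 (mul_ne_zero h1 h2)]
  linear_combination (qPochInf (a * b * q) q * qPochInf (a * c * q) q * qPochInf (a * d * q) q *
    qPochInf (b * c) q * qPochInf (b * d) q * qPochInf (c * d) q *
      qPochInf (a * b * c * d * q) q) * h

theorem awMass_mul_pow_left {q : ℝ} (hq0 : 0 < q) (hq1 : q < 1)
    (ha : ‖a‖ < 1) (hb : ‖b‖ < 1) (hc : ‖c‖ < 1) (hd : ‖d‖ < 1) (n : ℕ) :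
    awMass q (a * q ^ n) b c d = awMass q a b c d := by
  have hq : ‖(q : ℂ)‖ < 1 := by simpa [abs_of_pos hq0] using hq1
  induction n with
  | zero => simp
  | succ n ih =>
    have hn : ‖a * (q : ℂ) ^ n‖ < 1 := by
      rw [norm_mul, norm_pow]
      nlinarith [norm_nonneg a, pow_le_one₀ (n := n) (norm_nonneg _) hq.le]
    rw [pow_succ, ← mul_assoc, awMass_mul_left hq0 hq1 hn hb hc hd, ih]

theorem continuous_awMass (hq : ‖q‖ < 1) (hb : ‖b‖ < 1) (hc : ‖c‖ < 1) (hd : ‖d‖ < 1) :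
    Continuous fun a : Metric.ball (0 : ℂ) 1 => awMass q a b c d := by
  have hI : Continuous fun a : Metric.ball (0 : ℂ) 1 => awIntegral q a b c d :=
    intervalIntegral.continuous_parametric_intervalIntegral_of_continuous'
      (Continuous.awWeight_comp
      (continuous_subtype_val.comp continuous_fst) continuous_snd hq
      (fun p => mem_ball_zero_iff.mp p.1.2) hb hc hd) 0 π
  have h (s : ℂ) : Continuous fun a : Metric.ball (0 : ℂ) 1 => qPochInf (a * s) q :=
    (continuous_qPochInf hq).comp
      (by fun_prop : Continuous fun a : Metric.ball (0 : ℂ) 1 => (a : ℂ) * s)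
  have h' : Continuous fun a : Metric.ball (0 : ℂ) 1 => qPochInf (a * b * c * d) q :=
    (continuous_qPochInf hq).comp
      (by fun_prop : Continuous fun a : Metric.ball (0 : ℂ) 1 => (a : ℂ) * b * c * d)
  unfold awMass
  exact Continuous.div (hI.mul ((((((h b).mul (h c)).mul (h d)).mul continuous_const).mul
    continuous_const).mul continuous_const)) h' fun a => qPochInf_ne_zero hq
      (norm_mul_lt_one (norm_mul_lt_one (norm_mul_lt_one (mem_ball_zero_iff.mp a.2) hb) hc) hd)

/-- The mass is constant along `a q^n → 0` and continuous in its first parameter on the unit disc.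
-/
theorem awMass_eq_awMass_zero_left {q : ℝ} (hq0 : 0 < q) (hq1 : q < 1)
    (ha : ‖a‖ < 1) (hb : ‖b‖ < 1) (hc : ‖c‖ < 1) (hd : ‖d‖ < 1) :
    awMass q a b c d = awMass q 0 b c d := by
  have hq : ‖(q : ℂ)‖ < 1 := by simpa [abs_of_pos hq0] using hq1
  have hn (n : ℕ) : ‖a * (q : ℂ) ^ n‖ < 1 := by
    rw [norm_mul, norm_pow]
    nlinarith [norm_nonneg a, pow_le_one₀ (n := n) (norm_nonneg _) hq.le]
  let u (n : ℕ) : Metric.ball (0 : ℂ) 1 := ⟨a * (q : ℂ) ^ n, mem_ball_zero_iff.mpr (hn n)⟩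
  have hu : Tendsto u atTop (𝓝 ⟨0, by simp⟩) := by
    refine tendsto_subtype_rng.mpr ?_
    simpa using (tendsto_pow_atTop_nhds_zero_of_norm_lt_one hq).const_mul a
  have h := ((continuous_awMass hq hb hc hd).tendsto _).comp hu
  refine tendsto_nhds_unique (tendsto_const_nhds.congr fun n => ?_) h
  exact (awMass_mul_pow_left hq0 hq1 ha hb hc hd n).symm

theorem awMass_eq_awMass_zero {q : ℝ} (hq0 : 0 < q) (hq1 : q < 1)
    (ha : ‖a‖ < 1) (hb : ‖b‖ < 1) (hc : ‖c‖ < 1) (hd : ‖d‖ < 1) :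
    awMass q a b c d = awMass q 0 0 0 0 := by
  have h0 : ‖(0 : ℂ)‖ < 1 := by simp
  rw [awMass_eq_awMass_zero_left hq0 hq1 ha hb hc hd, awMass_rotate,
    awMass_eq_awMass_zero_left hq0 hq1 hb hc hd h0, awMass_rotate,
    awMass_eq_awMass_zero_left hq0 hq1 hc hd h0 h0, awMass_rotate,
    awMass_eq_awMass_zero_left hq0 hq1 hd h0 h0 h0]

/-- For the parameters `q, -q, √q, -√q` the Askey–Wilson weight is that of the Chebyshev
polynomials of the second kind. -/
theorem awWeight_chebyshev {r : ℂ} (hr : ‖r‖ < 1) (θ : ℝ) :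
    awWeight (r ^ 2) (r ^ 2) (-r ^ 2) r (-r) θ = ((4 * Real.sin θ ^ 2 : ℝ) : ℂ) := by
  have hq : ‖r ^ 2‖ < 1 := by simpa using pow_lt_one₀ (norm_nonneg r) hr two_ne_zero
  -- Pairing opposite signs gives `(r⁴z²; r⁴)_∞` and `(r²z²; r⁴)_∞`, the odd- and even-indexed
  -- factors of `(r²z²; r²)_∞`.
  have hprod (z : ℂ) : qPochInf (r ^ 2 * z) (r ^ 2) * qPochInf (-r ^ 2 * z) (r ^ 2) *
      qPochInf (r * z) (r ^ 2) * qPochInf (-r * z) (r ^ 2) = qPochInf (z ^ 2 * r ^ 2) (r ^ 2) := by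
    have h1 := qPochInf_mul_qPochInf_neg hq (r ^ 2 * z)
    have h2 := qPochInf_mul_qPochInf_neg hq (r * z)
    have h3 := qPochInf_sq_mul_qPochInf_sq hq (z ^ 2 * r ^ 2)
    rw [show z ^ 2 * r ^ 2 * r ^ 2 = (r ^ 2 * z) ^ 2 by ring, ← h1,
      show z ^ 2 * r ^ 2 = (r * z) ^ 2 by ring, ← h2] at h3
    rw [show z ^ 2 * r ^ 2 = (r * z) ^ 2 by ring, ← h3, neg_mul, neg_mul]
    ring
  have hn : ‖r ^ 2 * r ^ 2‖ < 1 := norm_mul_lt_one hq hq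
  have hne {z : ℂ} (hz : ‖z‖ = 1) : qPochInf (z ^ 2 * r ^ 2) (r ^ 2) ≠ 0 :=
    qPochInf_ne_zero hq (by rwa [norm_mul, norm_pow, hz, one_pow, one_mul])
  have hz := norm_exp_ofReal_mul_I θ
  rw [awWeight_eq_div_awDenom, awDenom, awDenom, hprod, hprod,
    qPochInf_eq_mul hq (exp (θ * I) ^ 2), qPochInf_eq_mul hq ((exp (θ * I))⁻¹ ^ 2),
    mul_mul_mul_comm, mul_div_assoc, div_self (mul_ne_zero (hne hz) (hne (by simp [hz]))), mul_one]
  have hs : ((4 * Real.sin θ ^ 2 : ℝ) : ℂ) = (2 * sin θ) ^ 2 := by push_cast; ring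
  have h1 : exp (θ * I) ≠ 0 := exp_ne_zero _
  rw [hs, two_sin, neg_mul, exp_neg, mul_pow, I_sq]
  field_simp
  ring

theorem awMass_chebyshev {r : ℂ} (hr : ‖r‖ < 1) :
    awMass (r ^ 2) (r ^ 2) (-r ^ 2) r (-r) = 2 * π / qPochInf (r ^ 2) (r ^ 2) := by
  have hq : ‖r ^ 2‖ < 1 := by simpa using pow_lt_one₀ (norm_nonneg r) hr two_ne_zero
  have hI : awIntegral (r ^ 2) (r ^ 2) (-r ^ 2) r (-r) = 2 * π := by
    simp only [awIntegral, awWeight_chebyshev hr]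
    rw [intervalIntegral.integral_ofReal, intervalIntegral.integral_const_mul, integral_sin_sq]
    simp
    ring
  set s : ℂ := r ^ 2 with hs
  have h1 := qPochInf_sq_mul_qPochInf_neg hq
  have h2 := qPochInf_mul_qPochInf_neg hq (r * s)
  have h3 := qPochInf_eq_mul hq (-s)
  have h4 := qPochInf_eq_mul hq s
  have h5 := qPochInf_eq_mul hq (s * s)
  have h6 := qPochInf_eq_mul (q := s ^ 2) (by simpa using pow_lt_one₀ (norm_nonneg s) hq two_ne_zero) s
  have hne := qPochInf_ne_zero hq hq
  have hne3 := qPochInf_ne_zero hq (norm_mul_lt_one (norm_mul_lt_one hq hq) hq)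
  have e1 : (r * s) ^ 2 = s * s ^ 2 := by rw [mul_pow, ← hs]
  rw [e1] at h2
  rw [h6] at h1
  rw [h5] at h4
  rw [awMass, hI, show s * -s = -s * s by ring, show s * r = r * s by ring,
    show s * -r = -(r * s) by ring, show -s * r = -(r * s) by ring,
    show -s * -r = r * s by ring, show r * -r = -s by rw [hs]; ring,
    show -s * s * r * -r = s * s * s by rw [hs]; ring, div_eq_div_iff hne3 hne, h4]
  -- Since `(rs, -rs; s)_∞ = (s³; s²)_∞`, the factors `1 - s` and `1 - s² = (1 - s)(1 + s)` complete
  -- the left side to the square of Euler's product `(s; s²)_∞ (-s; s)_∞ = 1`.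
  have h7 : qPochInf (-s * s) s * qPochInf (r * s) s * qPochInf (-(r * s)) s *
      qPochInf (-(r * s)) s * qPochInf (r * s) s * qPochInf (-s) s *
        ((1 - s) * (1 - s * s)) = 1 := by
    calc _ = ((1 - s) * (qPochInf (r * s) s * qPochInf (-(r * s)) s) *
          ((1 - -s) * qPochInf (-s * s) s)) *
          ((1 - s) * (qPochInf (r * s) s * qPochInf (-(r * s)) s) * qPochInf (-s) s) := by ring
      _ = 1 := by rw [h2, ← h3, h1, one_mul]
  linear_combination (2 * π * qPochInf (s * s * s) s) * h7

/-- The Askey–Wilson integral. -/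
theorem awMass_eq {q : ℝ} (hq0 : 0 < q) (hq1 : q < 1)
    (ha : ‖a‖ < 1) (hb : ‖b‖ < 1) (hc : ‖c‖ < 1) (hd : ‖d‖ < 1) :
    awMass q a b c d = 2 * π / qPochInf q q := by
  have hr : ‖((√q : ℝ) : ℂ)‖ < 1 := by
    rw [norm_real, Real.norm_of_nonneg (Real.sqrt_nonneg q)]
    exact (Real.sqrt_lt' one_pos).mpr (by simpa using hq1)
  have hr2 : ((√q : ℝ) : ℂ) ^ 2 = q := by exact_mod_cast Real.sq_sqrt hq0.le
  have hq : ‖(q : ℂ)‖ < 1 := by simpa [abs_of_pos hq0] using hq1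
  have h := awMass_chebyshev hr
  rw [hr2] at h
  rw [awMass_eq_awMass_zero hq0 hq1 ha hb hc hd, ← h]
  exact (awMass_eq_awMass_zero hq0 hq1 hq (by rwa [norm_neg]) hr (by rwa [norm_neg])).symm

theorem awNormalization_mul_awIntegral {q : ℝ} (hq0 : 0 < q) (hq1 : q < 1)
    (ha : ‖a‖ < 1) (hb : ‖b‖ < 1) (hc : ‖c‖ < 1) (hd : ‖d‖ < 1) :
    awNormalization q a b c d * awIntegral q a b c d = 1 := by
  have hq : ‖(q : ℂ)‖ < 1 := by simpa [abs_of_pos hq0] using hq1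
  have h := awMass_eq hq0 hq1 ha hb hc hd
  have h1 := qPochInf_ne_zero hq hq
  have hpi : (π : ℂ) ≠ 0 := by exact_mod_cast Real.pi_ne_zero
  calc _ = qPochInf q q / (2 * π) * awMass q a b c d := by
        rw [awNormalization, awMass]; ring
    _ = 1 := by rw [h]; field_simp

end AskeyWilsonIntegral

/-! ### The functional on the Newton basis -/

section Functional

open Complex MeasureTheory

variable {q a b c d : ℂ}

theorem awFunctional_eq_integral (hq : ‖q‖ < 1)
    (ha : ‖a‖ < 1) (hb : ‖b‖ < 1) (hc : ‖c‖ < 1) (hd : ‖d‖ < 1) (p : Polynomial ℂ) :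
    awFunctional q a b c d p = awNormalization q a b c d *
      ∫ θ in (0 : ℝ)..π, p.eval ((Real.cos θ : ℝ) : ℂ) * awWeight q a b c d θ := by
  have hW := continuous_awWeight hq ha hb hc hd
  have hint (p : Polynomial ℂ) : IntervalIntegrable
      (fun θ : ℝ => p.eval ((Real.cos θ : ℝ) : ℂ) * awWeight q a b c d θ) volume 0 π :=
    Continuous.intervalIntegrable (Continuous.mul (by fun_prop) hW) _ _
  induction p using Polynomial.induction_on' with
  | add p r hp hr =>
    rw [map_add, hp, hr, ← mul_add, ← intervalIntegral.integral_add (hint p) (hint r)]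
    simp only [Polynomial.eval_add, add_mul]
  | monomial n s =>
    have h : awFunctional q a b c d (Polynomial.monomial n 1) = awNormalization q a b c d *
        ∫ θ in (0 : ℝ)..π, ((Real.cos θ : ℝ) : ℂ) ^ n * awWeight q a b c d θ := by
      have hn : Polynomial.monomial n (1 : ℂ) = Polynomial.basisMonomials ℂ n := by
        rw [Polynomial.coe_basisMonomials]
      rw [awFunctional, hn, Module.Basis.constr_basis]
    rw [show Polynomial.monomial n s = s • Polynomial.monomial n (1 : ℂ) by
      rw [Polynomial.smul_monomial, smul_eq_mul, mul_one], map_smul, h, smul_eq_mul]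
    simp only [Polynomial.smul_monomial, smul_eq_mul, mul_one, Polynomial.eval_monomial, mul_assoc]
    rw [intervalIntegral.integral_const_mul]
    ring

theorem awWeight_mul_pow_left (hq : ‖q‖ < 1) (ha : ‖a‖ < 1) (b c d : ℂ) (n : ℕ) (θ : ℝ) :
    awWeight q (a * q ^ n) b c d θ =
      (∏ k ∈ Finset.range n, (1 - 2 * (a * q ^ k) * Real.cos θ + (a * q ^ k) ^ 2)) *
        awWeight q a b c d θ := by
  induction n with
  | zero => simp
  | succ n ih =>
    have hn : ‖a * q ^ n‖ < 1 := by
      rw [norm_mul, norm_pow]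
      nlinarith [norm_nonneg a, pow_le_one₀ (n := n) (norm_nonneg _) hq.le]
    rw [pow_succ, ← mul_assoc, awWeight_mul_left hq hn, ih, Finset.prod_range_succ]
    ring

/-- The node `a_k` is the root in `t` of `1 - 2aq^k t + a²q^{2k}`, whose leading coefficient is
`-2aq^k`; the powers `q^{-k}`, `k < n`, multiply to `q^{-binom(n,2)}`. -/
theorem prod_eq_mul_prod_sub_awNode (hq0 : q ≠ 0) (ha0 : a ≠ 0) (n : ℕ) (t : ℂ) :
    ∏ k ∈ Finset.range n, (t - awNode q a k) =
      (-1) ^ n * (2 * a) ^ (-(n : ℤ)) * q ^ (-(n.choose 2 : ℤ)) *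
        ∏ k ∈ Finset.range n, (1 - 2 * (a * q ^ k) * t + (a * q ^ k) ^ 2) := by
  induction n with
  | zero => simp
  | succ n ih =>
    rw [Finset.prod_range_succ, Finset.prod_range_succ, ih, Nat.choose_succ_succ' n 1,
      Nat.choose_one_right]
    generalize ∏ k ∈ Finset.range n, (1 - 2 * (a * q ^ k) * t + (a * q ^ k) ^ 2) = p
    simp only [awNode, zpow_neg, zpow_natCast, Nat.cast_add, Nat.cast_one, zpow_add₀ hq0,
      zpow_add₀ (mul_ne_zero two_ne_zero ha0), zpow_one]
    field_simp
    ring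

theorem awNormalization_mul_pow_left (hq : ‖q‖ < 1) (n : ℕ) :
    awNormalization q a b c d =
      qPoch (a * b) q n * qPoch (a * c) q n * qPoch (a * d) q n / qPoch (a * b * c * d) q n *
        awNormalization q (a * q ^ n) b c d := by
  rw [awNormalization, awNormalization, qPochInf_eq_qPoch_mul hq (a * b) n,
    qPochInf_eq_qPoch_mul hq (a * c) n, qPochInf_eq_qPoch_mul hq (a * d) n,
    qPochInf_eq_qPoch_mul hq (a * b * c * d) n,
    show a * q ^ n * b * c * d = a * b * c * d * q ^ n by ring,
    mul_right_comm a (q ^ n) b, mul_right_comm a (q ^ n) c, mul_right_comm a (q ^ n) d]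
  ring

/-- The product is absorbed into the weight as the shift `a ↦ a q^n`. The shifted weight has mass 1
under its own normalization, so only the ratio of normalizations and the constant of
`prod_eq_mul_prod_sub_awNode` remain. -/
theorem awFunctional_prod_sub_awNode {q : ℝ} (hq0 : 0 < q) (hq1 : q < 1) (ha : ‖a‖ < 1)
    (hb : ‖b‖ < 1) (hc : ‖c‖ < 1) (hd : ‖d‖ < 1) (ha0 : a ≠ 0) (n : ℕ) :
    awFunctional q a b c d
        (∏ k ∈ Finset.range n, (Polynomial.X - Polynomial.C (awNode q a k))) =
      qPoch (a * b) q n * qPoch (a * c) q n * qPoch (a * d) q n / qPoch (a * b * c * d) q n *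
        ((-1) ^ n * (2 * a) ^ (-(n : ℤ)) * (q : ℂ) ^ (-(n.choose 2 : ℤ))) := by
  have hq : ‖(q : ℂ)‖ < 1 := by simpa [abs_of_pos hq0] using hq1
  have hn : ‖a * (q : ℂ) ^ n‖ < 1 := by
    rw [norm_mul, norm_pow]
    nlinarith [norm_nonneg a, pow_le_one₀ (n := n) (norm_nonneg _) hq.le]
  rw [awFunctional_eq_integral hq ha hb hc hd]
  simp only [Polynomial.eval_prod, Polynomial.eval_sub, Polynomial.eval_X, Polynomial.eval_C,
    prod_eq_mul_prod_sub_awNode (ofReal_ne_zero.mpr hq0.ne') ha0, mul_assoc _ (∏ _ ∈ _, _),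
    ← awWeight_mul_pow_left hq ha]
  have h := awNormalization_mul_awIntegral hq0 hq1 hn hb hc hd
  rw [awIntegral] at h
  rw [intervalIntegral.integral_const_mul, awNormalization_mul_pow_left hq n]
  linear_combination (qPoch (a * b) q n * qPoch (a * c) q n * qPoch (a * d) q n /
    qPoch (a * b * c * d) q n * ((-1) ^ n * (2 * a) ^ (-(n : ℤ)) * (q : ℂ) ^ (-(n.choose 2 : ℤ)))) * h

end Functional

/-! ### Comparison of coefficients -/

theorem awTerm_eq_C_mul_nodeSeries (q a b c d : ℂ) (n : ℕ) :
    awTerm q a b c d n = PowerSeries.C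
      (qPoch (a * b) q n * qPoch (a * c) q n * qPoch (a * d) q n / qPoch (a * b * c * d) q n *
        ((-1) ^ n * (2 * a) ^ (-(n : ℤ)) * q ^ (-(n.choose 2 : ℤ)))) *
      nodeSeries (awNode q a) n := by
  rw [awTerm, nodeSeries, mul_assoc]

/-- The Newton expansion of a power, as an identity of polynomials. -/
theorem sum_coeff_nodeSeries_smul_prod {K : Type*} [Field K] [Infinite K] (x : ℕ → K) (k m : ℕ)
    (hm : k < m) :
    ∑ n ∈ Finset.range m, PowerSeries.coeff k (nodeSeries x n) •
      ∏ j ∈ Finset.range n, (Polynomial.X - Polynomial.C (x j)) = Polynomial.X ^ k := by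
  refine Polynomial.funext fun t => ?_
  simpa [Polynomial.eval_finsetSum, Polynomial.eval_prod] using
    sum_coeff_nodeSeries_mul_prod x t k m hm

theorem mainTheorem4 (q : ℝ) (hq0 : 0 < q) (hq1 : q < 1) (a b c d : ℂ)
    (ha : ‖a‖ < 1) (hb : ‖b‖ < 1) (hc : ‖c‖ < 1) (hd : ‖d‖ < 1) (ha0 : a ≠ 0) :
    HasFormalSum (awTerm (q : ℂ) a b c d)
      (PowerSeries.mk fun n : ℕ =>
        awFunctional (q : ℂ) a b c d ((Polynomial.X : Polynomial ℂ) ^ n)) := by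
  intro k
  -- Terms with `n > k` are divisible by `u^(k+1)`, so the `k`-th coefficient is settled once the
  -- partial sum contains all `n ≤ k`.
  filter_upwards [Filter.eventually_ge_atTop (Finset.range (k + 1))] with s hs
  have hcoeff (n : ℕ) : PowerSeries.coeff k (awTerm (q : ℂ) a b c d n) =
      PowerSeries.coeff k (nodeSeries (awNode q a) n) * awFunctional q a b c d
        (∏ j ∈ Finset.range n, (Polynomial.X - Polynomial.C (awNode q a j))) := by
    rw [awTerm_eq_C_mul_nodeSeries, PowerSeries.coeff_C_mul,
      awFunctional_prod_sub_awNode hq0 hq1 ha hb hc hd ha0, mul_comm]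
  rw [map_sum, PowerSeries.coeff_mk,
    ← sum_coeff_nodeSeries_smul_prod (awNode q a) k (k + 1) k.lt_succ_self, map_sum]
  simp only [hcoeff, map_smul, smul_eq_mul]
  refine (Finset.sum_subset hs fun n _ hn => ?_).symm
  rw [coeff_nodeSeries_eq_zero _ (by simpa using hn), zero_mul]
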